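/- Let $n\ge 1$ and let $J\subseteq \mathbb{Z}_{2n+1}\setminus\{0\}$ satisfy $|J|=n$ and $|\{j,-j\}\cap J|=1$ for every $j\in J$. The circulant tournament $\overrightarrow{C}_{2n+1}(J)$ has vertex set $\mathbb{Z}_{2n+1}$, with an arc from $i$ to $j$ exactly when $j-i\in J$. The composition $D[F]$ of digraphs $D$ and $F$ is the digraph on $V(D)\times V(F)$ with an arc from $(v,x)$ to $(w,y)$ exactly when $(v,w)$ is an arc of $D$, or $v=w$ and $(x,y)$ is an arc of $F$. A digraph is simple if it is not isomorphic to a composition $D[F]$ of digraphs $D$, $F$ with at least two vertices each. The $\overrightarrow{C}_3$-free disconnection $\overrightarrow{\omega}_3(D)$ of a digraph $D$ is the maximum number of connected components of the underlying graph of $D\setminus A(D^*)$ over all subdigraphs $D^*$ of $D$ that contain no directed triangle, where $A(D^*)$ is the arc set of $D^*$; a tournament $T$ is tight if $\overrightarrow{\omega}_3(T)=2$. Theorem. Every simple circulant tournament $\overrightarrow{C}_{2n+1}(J)$ is tight, i.e. $\overrightarrow{\omega}_3(\overrightarrow{C}_{2n+1}(J))=2$. -/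

import Mathlib

namespace CircTournament

universe u v

/-- `H` contains no directed triangle `x → y → z → x` on three distinct vertices. -/
def C3Free {V : Type u} (H : Digraph V) : Prop :=
  ¬ ∃ x y z : V, x ≠ y ∧ y ≠ z ∧ z ≠ x ∧ H.Adj x y ∧ H.Adj y z ∧ H.Adj z x

/-- The directed triangle-free disconnection of `D`: the largest number of connected components
of the underlying graph of `D` minus the arcs of `H`, where `H` runs over the directed
triangle-free subdigraphs of `D`. It takes values in `ℕ∞`, so that the supremum is a
maximum whenever it is finite. -/
noncomputable def omega3 {V : Type u} (D : Digraph V) : ℕ∞ :=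
  ⨆ H : {H : Digraph V // H ≤ D ∧ C3Free H},
    ENat.card (D \ H.1).toSimpleGraphInclusive.ConnectedComponent

/-- `D` is tight if its directed triangle-free disconnection is `2`. -/
def IsTight {V : Type u} (D : Digraph V) : Prop :=
  omega3 D = 2

/-- The composition (lexicographic product) `D[F]`: every vertex of `D` is replaced by a copy
of `F`, and between different copies all the arcs prescribed by `D` are put. -/
def composition {V : Type u} {W : Type v} (D : Digraph V) (F : Digraph W) : Digraph (V × W) where
  Adj p q := (p.1 = q.1 ∧ F.Adj p.2 q.2) ∨ D.Adj p.1 q.1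

/-- `D` is simple (prime) if it is not isomorphic to a composition of two digraphs with at
least two vertices each. -/
def IsSimple {V : Type u} (D : Digraph V) : Prop :=
  ∀ (V₁ V₂ : Type u) [Nontrivial V₁] [Nontrivial V₂] (D₁ : Digraph V₁) (D₂ : Digraph V₂),
    ¬ Nonempty (D.Adj ≃r (composition D₁ D₂).Adj)

/-- `J` is the symbol set of a circulant tournament on `ℤ/(2n+1)ℤ`. -/
structure IsSymbolSet (n : ℕ) (J : Finset (ZMod (2 * n + 1))) : Prop where
  zero_notMem : 0 ∉ J
  card_eq : J.card = n
  card_inter : ∀ j ∈ J, (({j, -j} : Finset (ZMod (2 * n + 1))) ∩ J).card = 1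

/-- The digraph on `ℤ/(2n+1)ℤ` with an arc from `i` to `j` exactly when `j - i ∈ J`. -/
def circulant (n : ℕ) (J : Finset (ZMod (2 * n + 1))) : Digraph (ZMod (2 * n + 1)) where
  Adj i j := j - i ∈ J

end CircTournament

namespace CircTournament

set_option linter.unusedSectionVars false

/-- The bipartite pattern `X → Y` in an arbitrary relation `r`: every element of `X` is related
to every element of `Y`. -/
def Dominates {V : Type*} (r : V → V → Prop) (X Y : Finset V) : Prop :=
  ∀ x ∈ X, ∀ y ∈ Y, r x y

/-! ### Cauchy–Davenport bound for prime tournament sets. -/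

section Additive

variable {G : Type*} [AddCommGroup G] [Fintype G] [DecidableEq G]

/-- A set `J` containing exactly one of `x`, `-x` for every `x ≠ 0`, and not containing `0`. -/
structure IsTournamentSet (n : ℕ) (J : Finset G) : Prop where
  zero_notMem : (0 : G) ∉ J
  total : ∀ x, x ≠ 0 → x ∈ J ∨ -x ∈ J
  anti : ∀ x ∈ J, -x ∉ J
  card_eq : J.card = n
  card_univ : Fintype.card G = 2 * n + 1

/-- No proper nontrivial subgroup is a homogeneous set of the Cayley tournament of `J`. -/
def IsPrimeSet (J : Finset G) : Prop :=
  ∀ H : AddSubgroup G, (∀ v ∉ H, v ∈ J → ∀ h ∈ H, v + h ∈ J) → H = ⊥ ∨ H = ⊤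

/-- The arc relation of the Cayley digraph of `J`. -/
def arc (J : Finset G) (x y : G) : Prop := y - x ∈ J

/-- Translate of a finite set. -/
def translateSet (t : G) (X : Finset G) : Finset G := X.map (Equiv.addRight t).toEmbedding

/-- Reflection of a finite set. -/
def negateSet (X : Finset G) : Finset G := X.map (Equiv.neg G).toEmbedding

theorem mem_translate {t x : G} {X : Finset G} : x ∈ translateSet t X ↔ x - t ∈ X := by
  simp only [translateSet, Finset.mem_map, Equiv.coe_toEmbedding, Equiv.coe_addRight]
  constructor
  · rintro ⟨a, ha, rfl⟩; simpa using ha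
  · intro h; exact ⟨_, h, by simp⟩

theorem mem_negate {x : G} {X : Finset G} : x ∈ negateSet X ↔ -x ∈ X := by
  simp only [negateSet, Finset.mem_map, Equiv.coe_toEmbedding, Equiv.neg_apply]
  constructor
  · rintro ⟨a, ha, rfl⟩; simpa using ha
  · intro h; exact ⟨_, h, by simp⟩

theorem card_translate (t : G) (X : Finset G) : (translateSet t X).card = X.card := Finset.card_map _

theorem card_negate (X : Finset G) : (negateSet X).card = X.card := Finset.card_map _

variable {n : ℕ} {J : Finset G} {X Y X' Y' : Finset G}

theorem Dominates.negate (h : Dominates (arc J) X Y) :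
    Dominates (arc J) (negateSet Y) (negateSet X) := by
  intro x hx y hy
  have := h _ (mem_negate.1 hy) _ (mem_negate.1 hx)
  simpa [arc, sub_eq_add_neg, add_comm] using this

theorem Dominates.translate (h : Dominates (arc J) X Y) (t : G) :
    Dominates (arc J) (translateSet t X) (translateSet t Y) := by
  intro x hx y hy
  have := h _ (mem_translate.1 hx) _ (mem_translate.1 hy)
  simpa [arc] using this

/-- Together with `Dominates.union_inter` this is the uncrossing step: the sizes of the two new
pairs add up to those of the two old ones. -/
theorem Dominates.inter_union (h : Dominates (arc J) X Y) (h' : Dominates (arc J) X' Y') :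
    Dominates (arc J) (X ∩ X') (Y ∪ Y') := by
  intro x hx y hy
  rw [Finset.mem_inter] at hx
  rcases Finset.mem_union.1 hy with hy | hy
  exacts [h x hx.1 y hy, h' x hx.2 y hy]

theorem Dominates.union_inter (h : Dominates (arc J) X Y) (h' : Dominates (arc J) X' Y') :
    Dominates (arc J) (X ∪ X') (Y ∩ Y') := by
  intro x hx y hy
  rw [Finset.mem_inter] at hy
  rcases Finset.mem_union.1 hx with hx | hx
  exacts [h x hx y hy.1, h' x hx y hy.2]

theorem Dominates.subset_translate (h : Dominates (arc J) X Y) {x : G} (hx : x ∈ X) :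
    Y ⊆ translateSet x J := fun y hy => mem_translate.2 (h x hx y hy)

theorem Dominates.card_right_le (hJ : IsTournamentSet n J) (h : Dominates (arc J) X Y)
    (hX : X.Nonempty) : Y.card ≤ n := by
  obtain ⟨x, hx⟩ := hX
  have := Finset.card_le_card (h.subset_translate hx)
  rwa [card_translate, hJ.card_eq] at this

/-- A common source dominates `Y ∪ Y'`, which therefore has at most `n` elements. -/
theorem Dominates.inter_nonempty (hJ : IsTournamentSet n J) (h : Dominates (arc J) X Y)
    (h' : Dominates (arc J) X' Y') (hX : (X ∩ X').Nonempty) (hc : n < Y.card + Y'.card) :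
    (Y ∩ Y').Nonempty := by
  have h1 := (h.inter_union h').card_right_le hJ hX
  have h2 := Finset.card_union_add_card_inter Y Y'
  rw [← Finset.card_pos]; omega

/-- A subgroup dominating a large set is homogeneous. -/
theorem homogeneous_of_dominates (hJ : IsTournamentSet n J) (H : AddSubgroup G)
    (hX : ∀ x, x ∈ X ↔ x ∈ H) (h : Dominates (arc J) X Y) (hYH : ∀ t ∈ H, translateSet t Y = Y)
    (hc : n + 2 ≤ X.card + Y.card) :
    ∀ v ∉ H, v ∈ J → ∀ t ∈ H, v + t ∈ J := by
  by_contra! hcon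
  obtain ⟨v, hvH, hvJ, t, ht, hvt⟩ := hcon
  have hYJ : ∀ y ∈ Y, y ∈ J := fun y hy => by
    simpa [arc] using h 0 ((hX 0).2 H.zero_mem) y hy
  have hYt : ∀ t ∈ H, ∀ y ∈ Y, y + t ∈ Y := fun t ht y hy => by
    rw [← hYH t ht, mem_translate]; simpa using hy
  -- The coset `v + H` now meets both `J` and `-J`, while `Y ⊆ J` is a union of cosets; hence
  -- neither `Y` nor `-Y` meets it.
  have hvt' : -(v + t) ∈ J := by
    refine (hJ.total _ ?_).resolve_left hvt
    intro h0
    exact hvH (by rw [eq_neg_of_add_eq_zero_left h0]; exact H.neg_mem ht)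
  -- `Y`, `-Y`, `H` and `v + H` are pairwise disjoint
  have key : ∀ y ∈ Y, y - v ∉ H := by
    intro y hy hyv
    have h1 : v + t ∈ Y := by
      have := hYt _ (H.add_mem (H.neg_mem hyv) ht) y hy
      rwa [show y + (-(y - v) + t) = v + t by abel] at this
    exact hvt (hYJ _ h1)
  have key' : ∀ y ∈ Y, y + v ∉ H := by
    intro y hy hyv
    have h1 : -v ∈ Y := by
      have := hYt _ (H.neg_mem hyv) y hy
      rwa [show y + -(y + v) = -v by abel] at this
    exact hJ.anti _ hvJ (hYJ _ h1)
  have keyH : ∀ y ∈ Y, y ∉ H := by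
    intro y hy hyH
    have := hYt _ (H.neg_mem hyH) y hy
    rw [add_neg_cancel] at this
    exact hJ.zero_notMem (hYJ _ this)
  have d1 : Disjoint Y (negateSet Y) := by
    rw [Finset.disjoint_left]; intro y hy hy'
    exact hJ.anti _ (hYJ _ hy) (hYJ _ (mem_negate.1 hy'))
  have d2 : Disjoint (Y ∪ negateSet Y) (X ∪ translateSet v X) := by
    rw [Finset.disjoint_left]; intro y hy hy'
    rw [Finset.mem_union, mem_translate, hX, hX] at hy'
    rw [Finset.mem_union, mem_negate] at hy
    rcases hy with hy | hy <;> rcases hy' with hy' | hy'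
    · exact keyH _ hy hy'
    · exact key _ hy hy'
    · exact keyH _ hy (H.neg_mem hy')
    · refine key' _ hy ?_
      have := H.neg_mem hy'
      rwa [neg_sub, sub_eq_neg_add] at this
  have d3 : Disjoint X (translateSet v X) := by
    rw [Finset.disjoint_left]; intro y hy hy'
    rw [mem_translate, hX] at hy'
    rw [hX] at hy
    exact hvH (by simpa using H.sub_mem hy hy')
  have hle := Finset.card_le_univ ((Y ∪ negateSet Y) ∪ (X ∪ translateSet v X))
  rw [Finset.card_union_of_disjoint d2, Finset.card_union_of_disjoint d1,
    Finset.card_union_of_disjoint d3, card_negate, card_translate, hJ.card_univ] at hle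
  omega

/-- In a prime Cayley tournament on `2n+1` vertices, `X → Y` forces `|X| + |Y| ≤ n + 1`. -/
theorem card_add_card_le (hJ : IsTournamentSet n J) (hP : IsPrimeSet J)
    (h : Dominates (arc J) X Y) (hX : X.Nonempty) (hY : Y.Nonempty) :
    X.card + Y.card ≤ n + 1 := by
  by_contra! hlt
  classical
  let S : Finset (Finset G × Finset G) := Finset.univ.filter fun p =>
    Dominates (arc J) p.1 p.2 ∧ p.1.Nonempty ∧ p.2.Nonempty
  have hS : ∀ {p}, p ∈ S ↔ Dominates (arc J) p.1 p.2 ∧ p.1.Nonempty ∧ p.2.Nonempty := by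
    simp [S]
  obtain ⟨p, hp, hpmax⟩ := S.exists_max_image (fun p => p.1.card + p.2.card)
    ⟨(X, Y), hS.2 ⟨h, hX, hY⟩⟩
  have hσ := hpmax (X, Y) (hS.2 ⟨h, hX, hY⟩)
  -- `S'` consists of the pairs of maximal total size; `q` has the smallest first side among them.
  -- Reflection exchanges the sides, whence `q.1.card ≤ q.2.card`.
  let S' := S.filter fun q => p.1.card + p.2.card ≤ q.1.card + q.2.card
  obtain ⟨q, hq, hqmin⟩ := S'.exists_min_image (fun q => q.1.card)
    ⟨p, Finset.mem_filter.2 ⟨hp, le_rfl⟩⟩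
  obtain ⟨hqS, hqσ⟩ := Finset.mem_filter.1 hq
  obtain ⟨hd, hne, hne'⟩ := hS.1 hqS
  have hle : q.1.card ≤ q.2.card := by
    have := hqmin (negateSet q.2, negateSet q.1) (Finset.mem_filter.2
      ⟨hS.2 ⟨hd.negate, Finset.map_nonempty.2 hne', Finset.map_nonempty.2 hne⟩, by
        simp only [card_negate]; omega⟩)
    simpa [card_negate] using this
  simp only at hσ
  -- The two pairs obtained by crossing with a translate have total size twice the maximum, so both
  -- are maximal. Minimality of `q.1` then makes `t` a period of both sides, and `q.1` is a coset of
  -- a subgroup.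
  have main : ∀ t, (q.1 ∩ translateSet t q.1).Nonempty → translateSet t q.1 = q.1 ∧ translateSet t q.2 = q.2 := by
    intro t ht
    have hY2 := hd.inter_nonempty hJ (hd.translate t) ht (by rw [card_translate]; omega)
    have c1 := Finset.card_union_add_card_inter q.1 (translateSet t q.1)
    have c2 := Finset.card_union_add_card_inter q.2 (translateSet t q.2)
    rw [card_translate] at c1 c2
    have m1 := hpmax (q.1 ∩ translateSet t q.1, q.2 ∪ translateSet t q.2) (hS.2
      ⟨hd.inter_union (hd.translate t), ht, hne'.mono Finset.subset_union_left⟩)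
    have m2 := hpmax (q.1 ∪ translateSet t q.1, q.2 ∩ translateSet t q.2) (hS.2
      ⟨hd.union_inter (hd.translate t), hne.mono Finset.subset_union_left, hY2⟩)
    simp only at m1 m2
    have m3 := hqmin (q.1 ∩ translateSet t q.1, q.2 ∪ translateSet t q.2) (Finset.mem_filter.2
      ⟨hS.2 ⟨hd.inter_union (hd.translate t), ht, hne'.mono Finset.subset_union_left⟩, by
        simp only; omega⟩)
    simp only at m3
    have e1 := Finset.eq_of_subset_of_card_le
      (Finset.inter_subset_left (s₁ := q.1) (s₂ := translateSet t q.1)) m3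
    have e2 := Finset.eq_of_subset_of_card_le
      (Finset.inter_subset_left (s₁ := q.2) (s₂ := translateSet t q.2)) (by omega)
    constructor
    · exact (Finset.eq_of_subset_of_card_le (Finset.inter_eq_left.1 e1)
        (card_translate _ _).le).symm
    · exact (Finset.eq_of_subset_of_card_le (Finset.inter_eq_left.1 e2)
        (card_translate _ _).le).symm
  obtain ⟨x₀, hx₀⟩ := hne
  have main' : ∀ t, x₀ + t ∈ q.1 → translateSet t q.1 = q.1 ∧ translateSet t q.2 = q.2 := fun t ht =>
    main t ⟨x₀ + t, Finset.mem_inter.2 ⟨ht, mem_translate.2 (by simpa using hx₀)⟩⟩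
  have hneg : ∀ t, x₀ + t ∈ q.1 → x₀ - t ∈ q.1 := fun t ht => by
    have : x₀ ∈ translateSet t q.1 := by rw [(main' t ht).1]; exact hx₀
    exact mem_translate.1 this
  let H : AddSubgroup G :=
    { carrier := {t | x₀ + t ∈ q.1}
      zero_mem' := by simpa using hx₀
      add_mem' := by
        intro a b ha hb
        show x₀ + (a + b) ∈ q.1
        rw [← (main' b hb).1, mem_translate]
        simpa [← add_assoc] using ha
      neg_mem' := by
        intro a ha
        simpa [sub_eq_add_neg] using hneg a ha }
  have hXH : ∀ x, x ∈ translateSet (-x₀) q.1 ↔ x ∈ H := fun x => by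
    rw [mem_translate, sub_neg_eq_add, add_comm]; rfl
  have hhom := homogeneous_of_dominates hJ H hXH (hd.translate (-x₀)) (by
    intro t ht
    ext y
    rw [mem_translate, mem_translate, mem_translate]
    conv_rhs => rw [← (main' t ht).2, mem_translate]
    rw [show y - t - -x₀ = y - -x₀ - t by abel]) (by simp only [card_translate]; omega)
  have hHtop : H ≠ ⊤ := by
    intro h0
    obtain ⟨y, hy⟩ := hne'
    have hy0 : y ∈ q.1 := by
      have : y - x₀ ∈ H := h0 ▸ AddSubgroup.mem_top _
      have : x₀ + (y - x₀) ∈ q.1 := this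
      simpa using this
    exact hJ.zero_notMem (by simpa [arc] using hd y hy0 y hy)
  have hHbot : H ≠ ⊥ := by
    intro h0
    have h1 : q.1.card ≤ 1 := Finset.card_le_one.2 fun a ha b hb => by
      have ha' : a - x₀ ∈ H := show x₀ + (a - x₀) ∈ q.1 by simpa using ha
      have hb' : b - x₀ ∈ H := show x₀ + (b - x₀) ∈ q.1 by simpa using hb
      rw [h0, AddSubgroup.mem_bot, sub_eq_zero] at ha' hb'
      rw [ha', hb']
    have h2 := hd.card_right_le hJ ⟨x₀, hx₀⟩
    omega
  exact (hP H hhom).elim hHbot hHtop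

end Additive

/-! ### Vosper-type theorem: critical pairs force a progression. -/

section Critical

variable {G : Type*} [AddCommGroup G] [Fintype G] [DecidableEq G]
variable {n : ℕ} {J : Finset G} {X Y X' Y' : Finset G}

theorem exists_nsmul_eq_of_zmultiples_eq_top (hcard : Fintype.card G = 2 * n + 1) {d : G}
    (hd : AddSubgroup.zmultiples d = ⊤) (x : G) : ∃ k < 2 * n + 1, x = k • d := by
  have h1 : addOrderOf d = 2 * n + 1 := by
    rw [← Nat.card_zmultiples, hd, AddSubgroup.card_top, Nat.card_eq_fintype_card, hcard]
  have hx : x ∈ AddSubgroup.zmultiples d := hd ▸ AddSubgroup.mem_top x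
  have hfin : IsOfFinAddOrder d := isOfFinAddOrder_of_finite d
  rw [← mem_multiples_iff_mem_zmultiples] at hx
  obtain ⟨k, hk⟩ := hx
  refine ⟨k % (2 * n + 1), Nat.mod_lt _ (by omega), ?_⟩
  rw [← h1, mod_addOrderOf_nsmul]
  exact hk.symm

/-- A set translated to itself has cardinality divisible by the order of the translation. -/
theorem addOrderOf_dvd_card_of_translate_eq {t : G} (h : translateSet t X = X) :
    addOrderOf t ∣ X.card := by
  have hclosed : ∀ z : ℤ, ∀ x ∈ X, x + z • t ∈ X := by
    have h1 : ∀ x ∈ X, x + t ∈ X := fun x hx => by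
      rw [← h, mem_translate]; simpa using hx
    have h2 : ∀ x ∈ X, x - t ∈ X := fun x hx => by
      rw [← h] at hx; exact mem_translate.1 hx
    intro z
    induction z using Int.induction_on with
    | zero => simp
    | succ i ih => intro x hx; rw [add_zsmul, one_zsmul, ← add_assoc]; exact h1 _ (ih x hx)
    | pred i ih =>
      intro x hx
      have := h2 _ (ih x hx)
      rwa [show x + -(i : ℤ) • t - t = x + (-(i : ℤ) - 1) • t by
        rw [sub_zsmul, one_zsmul]; abel] at this
  let H := AddSubgroup.zmultiples t
  have hH : ∀ v ∈ H, ∀ x ∈ X, x + v ∈ X := by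
    rintro v ⟨z, rfl⟩ x hx; exact hclosed z x hx
  classical
  have := Finset.card_eq_sum_card_image (fun x : G => (x : G ⧸ H)) X
  rw [this]
  refine Finset.dvd_sum fun q hq => ?_
  obtain ⟨x, hx, rfl⟩ := Finset.mem_image.1 hq
  have : (X.filter fun y : G => (y : G ⧸ H) = (x : G ⧸ H)).card = Nat.card H := by
    have hcard : Nat.card H = (Finset.univ.filter (· ∈ H)).card :=
      Nat.subtype_card (p := (· ∈ H)) _ (by simp)
    rw [hcard]
    symm
    refine Finset.card_bij (fun v _ => x + v) ?_ ?_ ?_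
    · intro v hv
      have hv : v ∈ H := by simpa using hv
      rw [Finset.mem_filter]
      refine ⟨hH v hv x hx, ?_⟩
      symm; rw [QuotientAddGroup.eq]; simpa using hv
    · intro a _ b _ hab; simpa using hab
    · intro y hy
      rw [Finset.mem_filter] at hy
      refine ⟨-x + y, ?_, by simp⟩
      have := QuotientAddGroup.eq.1 hy.2.symm
      simpa using this
  rw [this, Nat.card_zmultiples]

/-- If all but one element of a tournament set is stable under subtraction of `d`, then `d`
generates the group, provided the set is prime. -/
theorem zmultiples_eq_top_of_sub_mem (hJ : IsTournamentSet n J) (hP : IsPrimeSet J) {d e : G}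
    (hd : d ≠ 0) (h : ∀ j ∈ J, j ≠ e → j - d ∈ J) : AddSubgroup.zmultiples d = ⊤ := by
  have hfin : IsOfFinAddOrder d := isOfFinAddOrder_of_finite d
  have step : ∀ j ∈ J, (∀ k : ℕ, j - k • d ≠ e) → ∀ k : ℕ, j - k • d ∈ J := by
    intro j hj hne k
    induction k with
    | zero => simpa using hj
    | succ k ih => rw [succ_nsmul, ← sub_sub]; exact h _ ih (hne k)
  have hmem : ∀ x : G, x ∈ AddSubgroup.zmultiples d → ∃ k : ℕ, k • d = x := by
    intro x hx
    rw [← mem_multiples_iff_mem_zmultiples] at hx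
    exact hx
  -- Otherwise one could descend by `d` from `d` or `-d` inside `J` without meeting `e`, and reach
  -- `0`.
  have he : e ∈ AddSubgroup.zmultiples d := by
    by_contra he
    obtain ⟨j, hj, hjd⟩ : ∃ j ∈ J, j ∈ AddSubgroup.zmultiples d := by
      rcases hJ.total d hd with h1 | h1
      · exact ⟨d, h1, AddSubgroup.mem_zmultiples d⟩
      · exact ⟨-d, h1, neg_mem (AddSubgroup.mem_zmultiples d)⟩
    obtain ⟨k, hk⟩ := hmem j hjd
    have := step j hj (fun i hi => he (hi ▸ sub_mem hjd (nsmul_mem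
      (AddSubgroup.mem_zmultiples d) i))) k
    rw [hk, sub_self] at this
    exact hJ.zero_notMem this
  -- Cosets other than `⟨d⟩` avoid `e`, so `J` is a union of cosets off `⟨d⟩`.
  refine (hP (AddSubgroup.zmultiples d) ?_).resolve_left ?_
  · intro v hv hvJ t ht
    obtain ⟨k, hk⟩ := hmem (-t) (neg_mem ht)
    have := step v hvJ (fun i hi => hv (by
      rw [sub_eq_iff_eq_add] at hi
      rw [hi]
      exact add_mem he (nsmul_mem (AddSubgroup.mem_zmultiples d) i))) k
    rwa [hk, sub_neg_eq_add] at this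
  · rwa [AddSubgroup.zmultiples_eq_bot]

/-- A tournament set which is an arithmetic progression starting at its difference `d`. -/
theorem nsmul_mem_of_sub_mem (hJ : IsTournamentSet n J) {d e : G}
    (htop : AddSubgroup.zmultiples d = ⊤) (hd : d ∈ J) (h : ∀ j ∈ J, j ≠ e → j - d ∈ J) :
    ∀ i, 1 ≤ i → i ≤ n → i • d ∈ J := by
  have hed : e = d := by
    by_contra hne
    have := h d hd (Ne.symm hne)
    rw [sub_self] at this; exact hJ.zero_notMem this
  subst hed
  have horder : addOrderOf e = 2 * n + 1 := by
    rw [← Nat.card_zmultiples, htop, AddSubgroup.card_top, Nat.card_eq_fintype_card,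
      hJ.card_univ]
  have hinj : ∀ k < 2 * n + 1, k • e = e → k = 1 := by
    intro k hk hke
    have h1 : 1 < 2 * n + 1 := by
      have : 0 < J.card := Finset.card_pos.2 ⟨e, hd⟩
      rw [hJ.card_eq] at this; omega
    exact nsmul_injOn_Iio_addOrderOf (x := e) (Set.mem_Iio.2 (by omega)) (Set.mem_Iio.2 (by omega))
      (by simpa using hke)
  -- Only the multiple `1 • e` is exempt from the descent, so the exponents occurring in `J` form an
  -- initial segment starting at 1; its length is `n`.
  have down : ∀ m i : ℕ, 1 ≤ i → i + m < 2 * n + 1 → (i + m) • e ∈ J → i • e ∈ J := by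
    intro m
    induction m with
    | zero => intro i _ _ h; exact h
    | succ m ih =>
      intro i hi him hJm
      refine ih i hi (by omega) ?_
      have := h _ hJm (fun h0 => by have := hinj _ him h0; omega)
      rwa [← add_assoc, succ_nsmul, add_sub_cancel_right] at this
  intro i hi hin
  by_contra hnot
  have hsub : J ⊆ (Finset.Ico 1 i).image (fun k => k • e) := by
    intro j hj
    obtain ⟨k, hk, rfl⟩ := exists_nsmul_eq_of_zmultiples_eq_top hJ.card_univ htop j
    refine Finset.mem_image.2 ⟨k, Finset.mem_Ico.2 ⟨?_, ?_⟩, rfl⟩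
    · rcases Nat.eq_zero_or_pos k with rfl | hk0
      · rw [zero_nsmul] at hj; exact (hJ.zero_notMem hj).elim
      · exact hk0
    · by_contra! hik
      obtain ⟨m, rfl⟩ := Nat.exists_eq_add_of_le hik
      exact hnot (down m i hi hk hj)
  have := (Finset.card_le_card hsub).trans Finset.card_image_le
  rw [hJ.card_eq, Nat.card_Ico] at this
  omega

/-- A critical pair `X → Y` with `|X| = 2` yields an arithmetic progression. -/
theorem exists_sub_mem_of_pair (hJ : IsTournamentSet n J) (h : Dominates (arc J) X Y)
    (hc : Y.card + 1 = n) {x₁ x₂ : G} (h₁ : x₁ ∈ X) (h₂ : x₂ ∈ X) :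
    ∃ e, ∀ j ∈ J, j ≠ e → j - (x₂ - x₁) ∈ J := by
  have hsub : translateSet (-x₁) Y ⊆ J := by
    intro y hy
    rw [mem_translate, sub_neg_eq_add] at hy
    simpa [arc] using h x₁ h₁ _ hy
  -- The exception `e` is the one element of `J` outside `Y - x₁`; any other `j = y - x₁` gives `j -
  -- (x₂ - x₁) = y - x₂ ∈ J`.
  have hc1 : (J \ translateSet (-x₁) Y).card = 1 := by
    rw [Finset.card_sdiff_of_subset hsub, card_translate, hJ.card_eq]; omega
  obtain ⟨e, he⟩ := Finset.card_eq_one.1 hc1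
  refine ⟨e, fun j hj hje => ?_⟩
  have hjY : j ∈ translateSet (-x₁) Y := by
    by_contra hjn
    have : j ∈ J \ translateSet (-x₁) Y := Finset.mem_sdiff.2 ⟨hj, hjn⟩
    rw [he, Finset.mem_singleton] at this
    exact hje this
  rw [mem_translate, sub_neg_eq_add] at hjY
  have := h x₂ h₂ _ hjY
  rwa [arc, show j + x₁ - x₂ = j - (x₂ - x₁) by abel] at this

/-- A smallest critical pair has a side with two elements. -/
theorem exists_critical_pair_card_eq_two (hJ : IsTournamentSet n J) (hP : IsPrimeSet J)
    (h : Dominates (arc J) X Y) (hX : 2 ≤ X.card) (hY : 2 ≤ Y.card)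
    (hc : X.card + Y.card = n + 1) :
    ∃ X Y : Finset G, Dominates (arc J) X Y ∧ X.card = 2 ∧ Y.card + 1 = n := by
  classical
  let S : Finset (Finset G × Finset G) := Finset.univ.filter fun p =>
    Dominates (arc J) p.1 p.2 ∧ 2 ≤ p.1.card ∧ 2 ≤ p.2.card ∧ p.1.card + p.2.card = n + 1
  have hS : ∀ {p}, p ∈ S ↔
      Dominates (arc J) p.1 p.2 ∧ 2 ≤ p.1.card ∧ 2 ≤ p.2.card ∧ p.1.card + p.2.card = n + 1 := by
    simp [S]
  obtain ⟨q, hqS, hqmin⟩ := S.exists_min_image (fun q => q.1.card) ⟨(X, Y), hS.2 ⟨h, hX, hY, hc⟩⟩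
  obtain ⟨hd, hq1, hq2, hqc⟩ := hS.1 hqS
  have hle : q.1.card ≤ q.2.card := by
    have := hqmin (negateSet q.2, negateSet q.1) (hS.2
      ⟨hd.negate, by simpa [card_negate], by simpa [card_negate],
        by simp only [card_negate]; omega⟩)
    simpa [card_negate] using this
  have hpos : q.1.Nonempty := Finset.card_pos.1 (by omega)
  have hpos' : q.2.Nonempty := Finset.card_pos.1 (by omega)
  -- crossing critical pairs
  have cross : ∀ A B A' B' : Finset G, Dominates (arc J) A B → Dominates (arc J) A' B' →
      A.card + B.card = n + 1 → A'.card + B'.card = n + 1 → (A ∩ A').Nonempty →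
      n < B.card + B'.card →
      (A ∩ A').card + (B ∪ B').card = n + 1 ∧ (A ∪ A').card + (B ∩ B').card = n + 1 ∧
        (B ∩ B').Nonempty := by
    intro A B A' B' h1 h2 c1 c2 hne hlt
    have hne2 := h1.inter_nonempty hJ h2 hne hlt
    have e1 := Finset.card_union_add_card_inter A A'
    have e2 := Finset.card_union_add_card_inter B B'
    have m1 := card_add_card_le hJ hP (h1.inter_union h2) hne
      (hne2.mono (Finset.inter_subset_left.trans Finset.subset_union_left))
    have m2 := card_add_card_le hJ hP (h1.union_inter h2)
      (hne.mono (Finset.inter_subset_left.trans Finset.subset_union_left)) hne2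
    exact ⟨by omega, by omega, hne2⟩
  -- A larger intersection would be a critical pair again, and minimality would make `t` a period of
  -- both sides. Its order then divides `n + 1` and `2n + 1`, hence is 1.
  have small : ∀ t ≠ 0, (q.1 ∩ translateSet t q.1).Nonempty → (q.1 ∩ translateSet t q.1).card = 1 := by
    intro t ht hne
    obtain ⟨k1, k2, k3⟩ := cross _ _ _ _ hd (hd.translate t) hqc
      (by simpa only [card_translate] using hqc) hne (by rw [card_translate]; omega)
    by_contra h1
    have h0 := Finset.card_pos.2 hne
    have hYU := Finset.card_le_card (Finset.subset_union_left (s₁ := q.2) (s₂ := translateSet t q.2))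
    have m3 := hqmin (q.1 ∩ translateSet t q.1, q.2 ∪ translateSet t q.2) (hS.2
      ⟨hd.inter_union (hd.translate t), by simp only; omega, by simp only; omega, k1⟩)
    simp only at m3
    have e1 := Finset.eq_of_subset_of_card_le
      (Finset.inter_subset_left (s₁ := q.1) (s₂ := translateSet t q.1)) m3
    have e2 := Finset.eq_of_subset_of_card_le
      (Finset.subset_union_left (s₁ := q.2) (s₂ := translateSet t q.2)) (by omega)
    have p1 : translateSet t q.1 = q.1 := (Finset.eq_of_subset_of_card_le
      (Finset.inter_eq_left.1 e1) (card_translate _ _).le).symm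
    have p2 : translateSet t q.2 = q.2 := Finset.eq_of_subset_of_card_le
      (Finset.union_eq_left.1 e2.symm) (card_translate _ _).ge
    have o1 := addOrderOf_dvd_card_of_translate_eq p1
    have o2 := addOrderOf_dvd_card_of_translate_eq p2
    have o3 : addOrderOf t ∣ 2 * n + 1 := hJ.card_univ ▸ addOrderOf_dvd_card
    have o4 : addOrderOf t ∣ n + 1 := hqc ▸ dvd_add o1 o2
    have o5 : addOrderOf t ∣ 1 := by
      have := Nat.dvd_sub (o4.mul_left 2) o3
      rwa [show 2 * (n + 1) - (2 * n + 1) = 1 by omega] at this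
    exact ht (AddMonoid.addOrderOf_eq_one_iff.1 (Nat.dvd_one.1 o5))
  suffices hq12 : q.1.card = 2 from ⟨q.1, q.2, hd, hq12, by omega⟩
  by_contra hne2
  obtain ⟨u, hu, v, hv, w, hw, huv, huw, hvw⟩ := Finset.two_lt_card.1
    (show 2 < q.1.card by omega)
  -- the pairwise intersections of translates of `q.2`
  have pair : ∀ a ∈ q.1, ∀ b ∈ q.1, a ≠ b →
      (translateSet (-a) q.2 ∩ translateSet (-b) q.2).card + 2 * q.1.card = n + 2 := by
    intro a ha b hb hab
    have hne : (q.1 ∩ translateSet (a - b) q.1).Nonempty :=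
      ⟨a, Finset.mem_inter.2 ⟨ha, mem_translate.2 (by simpa using hb)⟩⟩
    obtain ⟨k1, k2, k3⟩ := cross _ _ _ _ hd (hd.translate (a - b)) hqc
      (by simpa only [card_translate] using hqc) hne (by rw [card_translate]; omega)
    have s := small (a - b) (sub_ne_zero.2 hab) hne
    have e1 := Finset.card_union_add_card_inter q.1 (translateSet (a - b) q.1)
    rw [card_translate] at e1
    have : translateSet (-a) q.2 ∩ translateSet (-b) q.2
        = translateSet (-a) (q.2 ∩ translateSet (a - b) q.2) := by
      ext y
      simp only [Finset.mem_inter, mem_translate]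
      rw [show y - -a - (a - b) = y - -b by abel]
    rw [this, card_translate]
    omega
  have inJ : ∀ a ∈ q.1, translateSet (-a) q.2 ⊆ J := by
    intro a ha y hy
    rw [mem_translate, sub_neg_eq_add] at hy
    simpa [arc] using hd a ha _ hy
  set Yu := translateSet (-u) q.2 with hYu
  set Yv := translateSet (-v) q.2 with hYv
  set Yw := translateSet (-w) q.2 with hYw
  have cu : Yu.card = q.2.card := card_translate _ _
  have cv : Yv.card = q.2.card := card_translate _ _
  have cw : Yw.card = q.2.card := card_translate _ _
  -- By `puv`, `Yu ∪ Yv` has `n` elements and so fills `J`. Thus `Yw` is covered by its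
  -- intersections with `Yu` and `Yv`, which gives `3|q.1| ≤ n + 3`.
  have i1 := Finset.card_union_add_card_inter Yu Yv
  have i2 := Finset.card_union_add_card_inter (Yu ∪ Yv) Yw
  have i3 : ((Yu ∪ Yv) ∩ Yw).card ≤ (Yu ∩ Yw).card + (Yv ∩ Yw).card := by
    rw [Finset.union_inter_distrib_right]; exact Finset.card_union_le _ _
  have i4 : (Yu ∪ Yv ∪ Yw).card ≤ n := by
    rw [← hJ.card_eq]
    exact Finset.card_le_card (Finset.union_subset (Finset.union_subset (inJ u hu) (inJ v hv))
      (inJ w hw))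
  have puv : (Yu ∩ Yv).card + 2 * q.1.card = n + 2 := pair u hu v hv huv
  have puw : (Yu ∩ Yw).card + 2 * q.1.card = n + 2 := pair u hu w hw huw
  have pvw : (Yv ∩ Yw).card + 2 * q.1.card = n + 2 := pair v hv w hw hvw
  -- the union of two translates
  have hne : (q.1 ∩ translateSet (u - v) q.1).Nonempty :=
    ⟨u, Finset.mem_inter.2 ⟨hu, mem_translate.2 (by simpa using hv)⟩⟩
  obtain ⟨k1, k2, k3⟩ := cross _ _ _ _ hd (hd.translate (u - v)) hqc
    (by simpa only [card_translate] using hqc) hne (by rw [card_translate]; omega)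
  have s := small (u - v) (sub_ne_zero.2 huv) hne
  have e1 := Finset.card_union_add_card_inter q.1 (translateSet (u - v) q.1)
  rw [card_translate] at e1
  have hk3 := Finset.card_pos.2 k3
  set X₂ := q.1 ∪ translateSet (u - v) q.1 with hX₂
  set Y₂ := q.2 ∩ translateSet (u - v) q.2 with hY₂
  have hd₂ : Dominates (arc J) X₂ Y₂ := hd.union_inter (hd.translate (u - v))
  have hbig : 2 ≤ Y₂.card := by omega
  -- Minimality against the reflected pair sharpens this to `3|q.1| ≤ n + 2`, just enough to cross
  -- `(X₂, Y₂)` with a third translate.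
  have m := hqmin (negateSet Y₂, negateSet X₂) (hS.2 ⟨hd₂.negate, by simpa [card_negate] using hbig,
    by simp only [card_negate]; omega, by simp only [card_negate]; omega⟩)
  simp only [card_negate] at m
  -- intersect with a third translateSet
  have hw1 : w ∈ q.1 ∩ translateSet (w - v) q.1 :=
    Finset.mem_inter.2 ⟨hw, mem_translate.2 (by simpa using hv)⟩
  have hw2 : w + u - v ∈ translateSet (u - v) q.1 ∩ translateSet (w - v) q.1 :=
    Finset.mem_inter.2 ⟨mem_translate.2 (by
      rwa [show w + u - v - (u - v) = w by abel]), mem_translate.2 (by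
      rwa [show w + u - v - (w - v) = u by abel])⟩
  have s1 := small (w - v) (sub_ne_zero.2 hvw.symm) ⟨_, hw1⟩
  have s2 : (translateSet (u - v) q.1 ∩ translateSet (w - v) q.1).card = 1 := by
    have : translateSet (u - v) q.1 ∩ translateSet (w - v) q.1
        = translateSet (u - v) (q.1 ∩ translateSet (w - u) q.1) := by
      ext y
      simp only [Finset.mem_inter, mem_translate]
      rw [show y - (u - v) - (w - u) = y - (w - v) by abel]
    rw [this, card_translate]
    refine small _ (sub_ne_zero.2 huw.symm) ⟨w, Finset.mem_inter.2 ⟨hw, mem_translate.2 ?_⟩⟩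
    simpa using hu
  -- The third translate meets each half of `X₂` in one point, and the points differ. So the crossed
  -- critical pair has a first side of size 2, against minimality.
  have hX3 : 2 ≤ (X₂ ∩ translateSet (w - v) q.1).card := by
    refine Finset.one_lt_card.2 ⟨w, ?_, w + u - v, ?_, ?_⟩
    · exact Finset.mem_inter.2 ⟨Finset.mem_union_left _ hw, (Finset.mem_inter.1 hw1).2⟩
    · exact Finset.mem_inter.2 ⟨Finset.mem_union_right _ (Finset.mem_inter.1 hw2).1,
        (Finset.mem_inter.1 hw2).2⟩
    · intro h0
      rw [add_sub_assoc, left_eq_add, sub_eq_zero] at h0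
      exact huv h0
  have hX3' : (X₂ ∩ translateSet (w - v) q.1).card ≤ 2 := by
    rw [hX₂, Finset.union_inter_distrib_right]
    exact (Finset.card_union_le _ _).trans (by omega)
  obtain ⟨l1, l2, l3⟩ := cross _ _ _ _ hd₂ (hd.translate (w - v)) k2
    (by simpa only [card_translate] using hqc) (Finset.card_pos.1 (by omega))
    (by rw [card_translate]; omega)
  have m' := hqmin (X₂ ∩ translateSet (w - v) q.1, Y₂ ∪ translateSet (w - v) q.2) (hS.2
    ⟨hd₂.inter_union (hd.translate (w - v)), hX3, by simp only; omega, l1⟩)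
  simp only at m'
  omega

/-- A prime tournament set with a critical pair both of whose sides have at least two elements is
an arithmetic progression `{d, 2d, …, nd}`, where `d` generates the group. -/
theorem exists_progression_of_critical (hJ : IsTournamentSet n J) (hP : IsPrimeSet J)
    (h : Dominates (arc J) X Y) (hX : 2 ≤ X.card) (hY : 2 ≤ Y.card)
    (hc : X.card + Y.card = n + 1) :
    ∃ d : G, AddSubgroup.zmultiples d = ⊤ ∧ ∀ i, 1 ≤ i → i ≤ n → i • d ∈ J := by
  obtain ⟨X, Y, h, hX, hY⟩ := exists_critical_pair_card_eq_two hJ hP h hX hY hc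
  obtain ⟨x₁, x₂, hne, rfl⟩ := Finset.card_eq_two.1 hX
  have hd : x₂ - x₁ ≠ 0 := sub_ne_zero.2 hne.symm
  have key : ∀ y₁ ∈ ({x₁, x₂} : Finset G), ∀ y₂ ∈ ({x₁, x₂} : Finset G), y₂ - y₁ ∈ J →
      y₂ - y₁ ≠ 0 →
      ∃ d : G, AddSubgroup.zmultiples d = ⊤ ∧ ∀ i, 1 ≤ i → i ≤ n → i • d ∈ J := by
    intro y₁ h₁ y₂ h₂ hmem h0
    obtain ⟨e, he⟩ := exists_sub_mem_of_pair hJ h hY h₁ h₂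
    have htop := zmultiples_eq_top_of_sub_mem hJ hP h0 he
    exact ⟨y₂ - y₁, htop, nsmul_mem_of_sub_mem hJ htop hmem he⟩
  rcases hJ.total _ hd with h1 | h1
  · exact key x₁ (by simp) x₂ (by simp) h1 hd
  · rw [neg_sub] at h1
    exact key x₂ (by simp) x₁ (by simp) h1 (sub_ne_zero.2 hne)

end Critical

/-! ### Cuts in colourings without rainbow cyclic triangles. -/

section Colouring

variable {V : Type*}

/-- A cyclic triangle of `r` whose vertices get three different colours. -/
def HasRainbowTriangle {κ : Type*} (r : V → V → Prop) (f : V → κ) : Prop :=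
  ∃ x y z, r x y ∧ r y z ∧ r z x ∧ f x ≠ f y ∧ f y ≠ f z ∧ f z ≠ f x

/-- `z` is reached from `x` by a walk of length `k` inside `M` whose arcs join different
colours. -/
def ReachIn (r : V → V → Prop) (f : V → Fin 3) (M : Finset V) : ℕ → V → V → Prop
  | 0, x, z => x = z
  | k + 1, x, z => ∃ w ∈ M, r x w ∧ f x ≠ f w ∧ ReachIn r f M k w z

variable {r : V → V → Prop} {f : V → Fin 3}

theorem ReachIn.snoc {M : Finset V} {k : ℕ} {x y z : V} (h : ReachIn r f M k x y) (hz : z ∈ M)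
    (hyz : r y z) (hf : f y ≠ f z) : ReachIn r f M (k + 1) x z := by
  induction k generalizing x with
  | zero => obtain rfl : x = y := h; exact ⟨z, hz, hyz, hf, rfl⟩
  | succ k ih =>
    obtain ⟨w, hw, h1, h2, h3⟩ := h
    exact ⟨w, hw, h1, h2, ih h3⟩

/-- Without rainbow cyclic triangles, there is no walk from `z` to `x` if `x → y → z` is a rainbow
path. -/
theorem not_reachIn_of_rainbow_path (htot : ∀ x y, f x ≠ f y → r x y ∨ r y x)
    (hno : ¬ HasRainbowTriangle r f) (M : Finset V) (k : ℕ) :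
    ∀ x y z, r x y → r y z → f x ≠ f y → f y ≠ f z → f x ≠ f z → ¬ ReachIn r f M k z x := by
  have trans : ∀ x y z, r x y → r y z → f x ≠ f y → f y ≠ f z → f x ≠ f z → r x z := by
    intro x y z h1 h2 n1 n2 n3
    exact (htot x z n3).resolve_right fun h3 => hno ⟨x, y, z, h1, h2, h3, n1, n2, n3.symm⟩
  induction k using Nat.strong_induction_on with
  | _ k ih =>
  intro x y z hxy hyz nxy nyz nxz hreach
  have hxz := trans x y z hxy hyz nxy nyz nxz
  match k, hreach with
  | 0, h => exact nxz (congrArg f h).symm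
  | 1, h =>
    obtain ⟨w, -, hzw, -, rfl⟩ := h
    exact hno ⟨z, w, y, hzw, hxy, hyz, nxz.symm, nxy, nyz⟩
  | k + 2, h =>
    obtain ⟨w, -, hzw, nzw, w₂, hw₂, hww₂, nww₂, hr⟩ := h
    -- If `z` and `w₂` differ in colour, `z → w₂` shortens the walk. Otherwise a rainbow path from
    -- `x` to `w₂`, through `w` or `y`, replaces the given one and two steps of the walk are
    -- dropped.
    by_cases n1 : f z = f w₂
    · by_cases n2 : f w = f y
      · by_cases h2 : r x w
        · exact ih k (by omega) x w w₂ h2 hww₂ (by rw [n2]; exact nxy) nww₂ (by rwa [← n1]) hr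
        · have hwx := (htot x w (by rw [n2]; exact nxy)).resolve_left h2
          have := trans z w x hzw hwx nzw (by rw [n2]; exact nxy.symm) nxz.symm
          exact hno ⟨z, x, y, this, hxy, hyz, nxz.symm, nxy, nyz⟩
      · have n3 : f w = f x := by omega
        by_cases h2 : r w y
        · exact hno ⟨z, w, y, hzw, h2, hyz, nzw, n2, nyz⟩
        have hyw := (htot w y n2).resolve_left h2
        by_cases h3 : r y w₂
        · exact ih k (by omega) x y w₂ hxy h3 nxy (by rwa [← n1]) (by rwa [← n1]) hr
        · have h4 := (htot y w₂ (by rwa [← n1])).resolve_left h3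
          exact hno ⟨w, w₂, y, hww₂, h4, hyw, nww₂, by rw [← n1]; exact nyz.symm, Ne.symm n2⟩
    · have := trans z w w₂ hzw hww₂ nzw nww₂ n1
      exact ih (k + 1) (by omega) x y z hxy hyz nxy nyz nxz ⟨w₂, hw₂, this, n1, hr⟩

variable [Fintype V] [DecidableEq V]

/-- `P` is a cut of `M`: all arcs of `r` between `P` and `M \ P` joining different colours are
directed from `P` to `M \ P`. -/
def IsCut (r : V → V → Prop) (f : V → Fin 3) (M P : Finset V) : Prop :=
  P ⊆ M ∧ ∀ x ∈ P, ∀ y ∈ M, y ∉ P → f x ≠ f y → r x y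

/-- A set with three colours and no rainbow cyclic triangle has a nontrivial cut. -/
theorem exists_cut (htot : ∀ x y, f x ≠ f y → r x y ∨ r y x)
    (hno : ¬ HasRainbowTriangle r f) (M : Finset V) (hM : ∀ i, ∃ x ∈ M, f x = i) :
    ∃ P, IsCut r f M P ∧ P.Nonempty ∧ (M \ P).Nonempty := by
  classical
  by_contra! hcon
  have reach : ∀ z ∈ M, ∀ x ∈ M, ∃ k, ReachIn r f M k z x := by
    intro z hz x hx
    by_contra! hzx
    -- The vertices unreachable from `z` form a cut: an arc back from a reached vertex of another
    -- colour would extend a walk.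
    let P := M.filter fun w => ∀ k, ¬ ReachIn r f M k z w
    have hP : IsCut r f M P := by
      refine ⟨Finset.filter_subset _ _, fun a ha b hb hbP hab => ?_⟩
      refine (htot a b hab).resolve_right fun hba => ?_
      obtain ⟨haM, ha⟩ := Finset.mem_filter.1 ha
      have : ∃ k, ReachIn r f M k z b := by
        by_contra! h
        exact hbP (Finset.mem_filter.2 ⟨hb, h⟩)
      obtain ⟨k, hk⟩ := this
      exact ha _ (hk.snoc haM hba hab.symm)
    have h1 := hcon P hP ⟨x, Finset.mem_filter.2 ⟨hx, hzx⟩⟩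
    have : z ∈ M \ P := Finset.mem_sdiff.2 ⟨hz, fun h => (Finset.mem_filter.1 h).2 0 rfl⟩
    rw [h1] at this
    simp at this
  have key : ∀ x y z, x ∈ M → z ∈ M → r x y → r y z → f x ≠ f y → f y ≠ f z → f x ≠ f z →
      False := by
    intro x y z hx hz h1 h2 n1 n2 n3
    obtain ⟨k, hk⟩ := reach z hz x hx
    exact not_reachIn_of_rainbow_path htot hno M k x y z h1 h2 n1 n2 n3 hk
  obtain ⟨x, hx, fx⟩ := hM 0
  obtain ⟨y, hy, fy⟩ := hM 1
  obtain ⟨z, hz, fz⟩ := hM 2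
  have nxy : f x ≠ f y := by rw [fx, fy]; decide
  have nyz : f y ≠ f z := by rw [fy, fz]; decide
  have nxz : f x ≠ f z := by rw [fx, fz]; decide
  rcases htot x y nxy with h1 | h1 <;> rcases htot y z nyz with h2 | h2
  · exact key x y z hx hz h1 h2 nxy nyz nxz
  · rcases htot x z nxz with h3 | h3
    · exact key x z y hx hy h3 h2 nxz nyz.symm nxy
    · exact key z x y hz hy h3 h1 nxz.symm nxy nyz.symm
  · rcases htot x z nxz with h3 | h3
    · exact key y x z hy hz h1 h3 nxy.symm nxz nyz
    · exact key y z x hy hx h2 h3 nyz nxz.symm nxy.symm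
  · exact key z y x hz hx h2 h1 nyz.symm nxy.symm nxz.symm

end Colouring

/-! ### Tournaments without critical pairs. -/

section Cuts

variable {V : Type*} [Fintype V] [DecidableEq V] {n : ℕ} {r : V → V → Prop} {f : V → Fin 3}

/-- The vertices of colour `i` lie on both sides of the cut `P`, and so do the others. -/
def Splits (f : V → Fin 3) (P : Finset V) (i : Fin 3) : Prop :=
  (∃ x ∈ P, f x = i) ∧ (∃ x ∈ P, f x ≠ i) ∧ (∃ x, x ∉ P ∧ f x = i) ∧ ∃ x, x ∉ P ∧ f x ≠ i

theorem card_filter_add_four (P : Finset V) (i : Fin 3) :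
    (P.filter (f · = i)).card + (P.filter (f · ≠ i)).card +
      ((Pᶜ.filter (f · = i)).card + (Pᶜ.filter (f · ≠ i)).card) = Fintype.card V := by
  rw [Finset.card_filter_add_card_filter_not, Finset.card_filter_add_card_filter_not,
    Finset.card_add_card_compl]

theorem exists_third_colour (hf : Function.Surjective f) (i j : Fin 3) :
    ∃ y, f y ≠ i ∧ f y ≠ j := by
  obtain ⟨k, hk1, hk2⟩ : ∃ k : Fin 3, k ≠ i ∧ k ≠ j := by revert i j; decide
  obtain ⟨y, rfl⟩ := hf k
  exact ⟨y, hk1, hk2⟩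

/-- These are two of the four extremal cases of `IsCut.not_splits`; reversing all arcs yields the
others. In each, some vertex would have out-degree `n + 1`. -/
theorem not_splits_of_card_eq_one (hcard : Fintype.card V = 2 * n + 1)
    (htot : ∀ x y, x ≠ y → r x y ∨ r y x)
    (hM : ∀ X Y : Finset V, Dominates r X Y → X.Nonempty → Y.Nonempty → X.card + Y.card ≤ n + 1)
    (hN : ∀ X Y : Finset V, Dominates r X Y → 2 ≤ X.card → 2 ≤ Y.card → X.card + Y.card ≠ n + 1)
    (hf : Function.Surjective f) {P : Finset V} (hP : IsCut r f Finset.univ P) {i : Fin 3}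
    (h : ((P.filter (f · ≠ i)).card = 1 ∧ (Pᶜ.filter (f · = i)).card = n) ∨
      ((P.filter (f · = i)).card = 1 ∧ (Pᶜ.filter (f · ≠ i)).card = n)) :
    ¬ Splits f P i := by
  rintro ⟨⟨x₁, hx₁, fx₁⟩, ⟨x₂, hx₂, fx₂⟩, ⟨y₁, hy₁, fy₁⟩, ⟨y₂, hy₂, fy₂⟩⟩
  have cut : ∀ x ∈ P, ∀ y, y ∉ P → f x ≠ f y → r x y := fun x hx y hy =>
    hP.2 x hx y (Finset.mem_univ y) hy
  have single : ∀ x (Y : Finset V), (∀ y ∈ Y, r x y) → Y.card ≤ n := by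
    intro x Y hY
    rcases Y.eq_empty_or_nonempty with rfl | hne
    · simp
    have := hM {x} Y (by intro a ha y hy; rw [Finset.mem_singleton.1 ha]; exact hY y hy)
      (Finset.singleton_nonempty x) hne
    rw [Finset.card_singleton] at this; omega
  have htotal := card_filter_add_four (f := f) P i
  rw [hcard] at htotal
  rcases h with ⟨h1, h2⟩ | ⟨h1, h2⟩
  · obtain ⟨y, hyi, hyx⟩ := exists_third_colour hf i (f x₂)
    have hyP : y ∉ P := fun hyP => by
      have := Finset.card_le_one.1 h1.le y (by simp [hyP, hyi]) x₂ (by simp [hx₂, fx₂])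
      exact hyx (congrArg f this)
    have := single x₂ (insert y (Pᶜ.filter (f · = i))) (by
      intro z hz
      rcases Finset.mem_insert.1 hz with rfl | hz
      · exact cut _ hx₂ _ hyP (Ne.symm hyx)
      · simp only [Finset.mem_filter, Finset.mem_compl] at hz
        exact cut _ hx₂ _ hz.1 (by rw [hz.2]; exact fx₂))
    rw [Finset.card_insert_of_notMem (by simp [hyi]), h2] at this
    omega
  -- `x₁` already has `n` out-neighbours outside `P`, so all its arcs within `P` to other colours
  -- point towards it. Adding `x₁` to the dominated set makes the second pair critical.
  · have hin : ∀ p ∈ P.filter (f · ≠ i), r p x₁ := by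
      intro p hp
      obtain ⟨hpP, hpi⟩ := Finset.mem_filter.1 hp
      refine (htot p x₁ (fun h => hpi (h ▸ fx₁))).resolve_right fun hxp => ?_
      have := single x₁ (insert p (Pᶜ.filter (f · ≠ i))) (by
        intro z hz
        rcases Finset.mem_insert.1 hz with rfl | hz
        · exact hxp
        · simp only [Finset.mem_filter, Finset.mem_compl] at hz
          exact cut _ hx₁ _ hz.1 (by rw [fx₁]; exact Ne.symm hz.2))
      rw [Finset.card_insert_of_notMem (by simp [hpP]), h2] at this
      omega
    have hdom : ∀ p ∈ P.filter (f · ≠ i), ∀ z ∈ insert x₁ (Pᶜ.filter (f · = i)), r p z := by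
      intro p hp z hz
      rcases Finset.mem_insert.1 hz with rfl | hz
      · exact hin p hp
      · obtain ⟨hpP, hpi⟩ := Finset.mem_filter.1 hp
        simp only [Finset.mem_filter, Finset.mem_compl] at hz
        exact cut _ hpP _ hz.1 (by rw [hz.2]; exact hpi)
    have hc : (insert x₁ (Pᶜ.filter (f · = i))).card = (Pᶜ.filter (f · = i)).card + 1 :=
      Finset.card_insert_of_notMem (by simp [hx₁])
    have hpos : 0 < (Pᶜ.filter (f · = i)).card :=
      Finset.card_pos.2 ⟨y₁, by simp [hy₁, fy₁]⟩
    have hb : (P.filter (f · ≠ i)).card ≤ 1 := by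
      by_contra! hlt
      exact hN _ _ hdom hlt (by omega) (by omega)
    have hb0 : 0 < (P.filter (f · ≠ i)).card := Finset.card_pos.2 ⟨x₂, by simp [hx₂, fx₂]⟩
    obtain ⟨y, hyi, hyx⟩ := exists_third_colour hf i (f x₂)
    have hyP : y ∉ P := fun hyP => by
      have := Finset.card_le_one.1 hb y (by simp [hyP, hyi]) x₂ (by simp [hx₂, fx₂])
      exact hyx (congrArg f this)
    have := single x₂ (insert y (insert x₁ (Pᶜ.filter (f · = i)))) (by
      intro z hz
      rcases Finset.mem_insert.1 hz with rfl | hz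
      · exact cut _ hx₂ _ hyP (Ne.symm hyx)
      · exact hdom x₂ (by simp [hx₂, fx₂]) z hz)
    rw [Finset.card_insert_of_notMem, hc] at this
    · omega
    · rw [Finset.mem_insert]
      rintro (h | h)
      · exact hyi (h ▸ fx₁)
      · exact hyi (Finset.mem_filter.1 h).2

theorem IsCut.flip_compl {P : Finset V} (hP : IsCut r f Finset.univ P) :
    IsCut (flip r) f Finset.univ Pᶜ :=
  ⟨Finset.subset_univ _, fun x hx y _ hy hxy =>
    hP.2 y (by simpa using hy) x (Finset.mem_univ _) (by simpa using hx) hxy.symm⟩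

theorem Dominates.of_flip {X Y : Finset V} (h : Dominates (flip r) X Y) : Dominates r Y X :=
  fun x hx y hy => h y hy x hx

/-- In a tournament without critical pairs, no colour is split by a cut. -/
theorem IsCut.not_splits (hcard : Fintype.card V = 2 * n + 1)
    (htot : ∀ x y, x ≠ y → r x y ∨ r y x)
    (hM : ∀ X Y : Finset V, Dominates r X Y → X.Nonempty → Y.Nonempty → X.card + Y.card ≤ n + 1)
    (hN : ∀ X Y : Finset V, Dominates r X Y → 2 ≤ X.card → 2 ≤ Y.card → X.card + Y.card ≠ n + 1)
    (hf : Function.Surjective f) {P : Finset V} (hP : IsCut r f Finset.univ P) (i : Fin 3) :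
    ¬ Splits f P i := by
  intro hs
  obtain ⟨⟨x₁, hx₁, fx₁⟩, ⟨x₂, hx₂, fx₂⟩, ⟨y₁, hy₁, fy₁⟩, ⟨y₂, hy₂, fy₂⟩⟩ := id hs
  have ha : 0 < (P.filter (f · = i)).card := Finset.card_pos.2 ⟨x₁, by simp [hx₁, fx₁]⟩
  have hb : 0 < (P.filter (f · ≠ i)).card := Finset.card_pos.2 ⟨x₂, by simp [hx₂, fx₂]⟩
  have hc : 0 < (Pᶜ.filter (f · = i)).card := Finset.card_pos.2 ⟨y₁, by simp [hy₁, fy₁]⟩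
  have hd : 0 < (Pᶜ.filter (f · ≠ i)).card := Finset.card_pos.2 ⟨y₂, by simp [hy₂, fy₂]⟩
  have htotal := card_filter_add_four (f := f) P i
  rw [hcard] at htotal
  have d1 : Dominates r (P.filter (f · = i)) (Pᶜ.filter (f · ≠ i)) := by
    intro x hx y hy
    simp only [Finset.mem_filter, Finset.mem_compl] at hx hy
    exact hP.2 x hx.1 y (Finset.mem_univ _) hy.1 (by rw [hx.2]; exact Ne.symm hy.2)
  have d2 : Dominates r (P.filter (f · ≠ i)) (Pᶜ.filter (f · = i)) := by
    intro x hx y hy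
    simp only [Finset.mem_filter, Finset.mem_compl] at hx hy
    exact hP.2 x hx.1 y (Finset.mem_univ _) hy.1 (by rw [hy.2]; exact hx.2)
  have m1 := hM _ _ d1 (Finset.card_pos.1 ha) (Finset.card_pos.1 hd)
  have m2 := hM _ _ d2 (Finset.card_pos.1 hb) (Finset.card_pos.1 hc)
  have n1 := hN _ _ d1
  have n2 := hN _ _ d2
  -- The two pairs have total size `2n + 1` and each at most `n + 1`; so one has size exactly `n +
  -- 1`, and by `hN` a singleton side.
  by_cases h : ((P.filter (f · ≠ i)).card = 1 ∧ (Pᶜ.filter (f · = i)).card = n) ∨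
      ((P.filter (f · = i)).card = 1 ∧ (Pᶜ.filter (f · ≠ i)).card = n)
  · exact not_splits_of_card_eq_one hcard htot hM hN hf hP h hs
  · refine not_splits_of_card_eq_one (r := flip r) (f := f) (P := Pᶜ) (i := i) hcard
      (fun x y hxy => (htot x y hxy).symm)
      (fun X Y h hX hY => by rw [add_comm]; exact hM Y X h.of_flip hY hX)
      (fun X Y h hX hY => by rw [add_comm]; exact hN Y X h.of_flip hY hX) hf hP.flip_compl ?_ ?_
    · rw [compl_compl]; omega
    · refine ⟨⟨y₁, by simpa, fy₁⟩, ⟨y₂, by simpa, fy₂⟩, ⟨x₁, by simpa, fx₁⟩, ⟨x₂, by simpa, fx₂⟩⟩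

/-- `P` and its complement are too large for `P` to dominate it, so some `p ∈ P` and `q ∉ P` share a
colour; that colour is the witness. -/
theorem splits_or_monochromatic (hcard : Fintype.card V = 2 * n + 1) (hn : 1 ≤ n)
    (hM : ∀ X Y : Finset V, Dominates r X Y → X.Nonempty → Y.Nonempty → X.card + Y.card ≤ n + 1)
    {P : Finset V} (hP : IsCut r f Finset.univ P) (hne : P.Nonempty) (hne' : Pᶜ.Nonempty) :
    ∃ i, Splits f P i ∨ (∀ x ∈ P, f x = i) ∨ ∀ x ∈ Pᶜ, f x = i := by
  have h : ¬ Dominates r P Pᶜ := fun h => by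
    have := hM _ _ h hne hne'
    rw [Finset.card_add_card_compl, hcard] at this
    omega
  unfold Dominates at h
  push Not at h
  obtain ⟨p, hp, q, hq, hpq⟩ := h
  have hfpq : f p = f q := by
    by_contra h
    exact hpq (hP.2 p hp q (Finset.mem_univ _) (Finset.mem_compl.1 hq) h)
  refine ⟨f p, ?_⟩
  by_contra! hcon
  obtain ⟨h1, ⟨x, hx, hxp⟩, ⟨y, hy, hyp⟩⟩ := hcon
  exact h1 ⟨⟨p, hp, rfl⟩, ⟨x, hx, hxp⟩, ⟨q, Finset.mem_compl.1 hq, hfpq.symm⟩,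
    ⟨y, Finset.mem_compl.1 hy, hyp⟩⟩

/-- The monochromatic initial and final parts of cuts have the same colour. -/
theorem colour_eq_of_monochromatic (hcard : Fintype.card V = 2 * n + 1)
    (hM : ∀ X Y : Finset V, Dominates r X Y → X.Nonempty → Y.Nonempty → X.card + Y.card ≤ n + 1)
    (hf : Function.Surjective f) {P Q : Finset V} (hP : IsCut r f Finset.univ P)
    (hQ : IsCut r f Finset.univ Qᶜ) (hPne : P.Nonempty) (hQne : Q.Nonempty) {i j : Fin 3}
    (hPi : ∀ x ∈ P, f x = i) (hQj : ∀ x ∈ Q, f x = j) : i = j := by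
  by_contra hij
  obtain ⟨y, hyi, hyj⟩ := exists_third_colour hf i j
  have d1 : Dominates r P (Finset.univ.filter (f · ≠ i)) := by
    intro x hx z hz
    have hz := (Finset.mem_filter.1 hz).2
    exact hP.2 x hx z (Finset.mem_univ _) (fun h => hz (hPi z h)) (by rw [hPi x hx]; exact hz.symm)
  have d2 : Dominates r (Finset.univ.filter (f · ≠ j)) Q := by
    intro x hx z hz
    have hx := (Finset.mem_filter.1 hx).2
    exact hQ.2 x (Finset.mem_compl.2 fun h => hx (hQj x h)) z (Finset.mem_univ _) (by simpa using hz)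
      (by rw [hQj z hz]; exact hx)
  have m1 := hM _ _ d1 hPne ⟨y, by simp [hyi]⟩
  have m2 := hM _ _ d2 ⟨y, by simp [hyj]⟩ hQne
  have hPc := Finset.card_pos.2 hPne
  have hQc := Finset.card_pos.2 hQne
  have hcov : (Finset.univ : Finset V) ⊆
      Finset.univ.filter (f · ≠ i) ∪ Finset.univ.filter (f · ≠ j) := by
    intro x _
    simp only [Finset.mem_union, Finset.mem_filter, Finset.mem_univ, true_and]
    by_contra! h
    exact hij (h.1.symm.trans h.2)
  have := (Finset.card_le_card hcov).trans (Finset.card_union_le _ _)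
  rw [Finset.card_univ, hcard] at this
  omega

/-- If there are no rainbow cyclic triangles, then some cut splits some colour. -/
theorem exists_splits (hcard : Fintype.card V = 2 * n + 1) (hn : 1 ≤ n)
    (htot : ∀ x y, x ≠ y → r x y ∨ r y x)
    (hM : ∀ X Y : Finset V, Dominates r X Y → X.Nonempty → Y.Nonempty → X.card + Y.card ≤ n + 1)
    (hf : Function.Surjective f) (hno : ¬ HasRainbowTriangle r f) :
    ∃ P i, IsCut r f Finset.univ P ∧ Splits f P i := by
  classical
  by_contra! hcon
  have htot' : ∀ x y, f x ≠ f y → r x y ∨ r y x := fun x y h => htot x y (ne_of_apply_ne f h)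
  have mono : ∀ P, IsCut r f Finset.univ P → P.Nonempty → Pᶜ.Nonempty →
      ∃ i, (∀ x ∈ P, f x = i) ∨ ∀ x ∈ Pᶜ, f x = i := by
    intro P hP h1 h2
    obtain ⟨i, hi⟩ := splits_or_monochromatic hcard hn hM hP h1 h2
    exact ⟨i, hi.resolve_left (hcon P i hP)⟩
  have cut_empty : IsCut r f Finset.univ ∅ := ⟨Finset.subset_univ _, by simp⟩
  have cut_univ : IsCut r f Finset.univ (∅ : Finset V)ᶜ := ⟨Finset.subset_univ _, by simp⟩
  obtain ⟨P₀, hP₀, hne₀, hne₀'⟩ := exists_cut htot' hno Finset.univ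
    (fun i => (hf i).imp fun x hx => ⟨Finset.mem_univ x, hx⟩)
  rw [← Finset.compl_eq_univ_sdiff] at hne₀'
  obtain ⟨i, hi⟩ := mono P₀ hP₀ hne₀ hne₀'
  let S : Finset (Finset V × Finset V) := Finset.univ.filter fun p =>
    IsCut r f Finset.univ p.1 ∧ IsCut r f Finset.univ p.2ᶜ ∧ (∀ x ∈ p.1, f x = i) ∧
      (∀ x ∈ p.2, f x = i) ∧ Disjoint p.1 p.2 ∧ 0 < p.1.card + p.2.card
  have hS : ∀ {p}, p ∈ S ↔ IsCut r f Finset.univ p.1 ∧ IsCut r f Finset.univ p.2ᶜ ∧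
      (∀ x ∈ p.1, f x = i) ∧ (∀ x ∈ p.2, f x = i) ∧ Disjoint p.1 p.2 ∧
      0 < p.1.card + p.2.card := by
    simp [S]
  have hSne : S.Nonempty := by
    rcases hi with hi | hi
    · exact ⟨(P₀, ∅), hS.2 ⟨hP₀, cut_univ, hi, by simp, by simp, by
        simpa using Finset.card_pos.2 hne₀⟩⟩
    · exact ⟨(∅, P₀ᶜ), hS.2 ⟨cut_empty, by simpa using hP₀, by simp, hi, by simp, by
        simpa using Finset.card_pos.2 hne₀'⟩⟩
  obtain ⟨⟨P, Q⟩, hPQ, hmax⟩ := S.exists_max_image (fun p => p.1.card + p.2.card) hSne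
  obtain ⟨hP, hQ, hPi, hQi, hdisj, hpos⟩ := hS.1 hPQ
  simp only at hP hQ hPi hQi hdisj hpos hmax
  obtain ⟨M, hMdef⟩ : ∃ M, M = (P ∪ Q)ᶜ := ⟨_, rfl⟩
  have memM : ∀ x, x ∈ M ↔ x ∉ P ∧ x ∉ Q := by
    intro x; rw [hMdef, Finset.mem_compl, Finset.mem_union]; tauto
  have hMoff : ∀ x, f x ≠ i → x ∈ M := fun x hx =>
    (memM x).2 ⟨fun h => hx (hPi x h), fun h => hx (hQi x h)⟩
  have hcM : P.card + Q.card + M.card = 2 * n + 1 := by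
    rw [← Finset.card_union_of_disjoint hdisj, hMdef, Finset.card_add_card_compl, hcard]
  by_cases hMi : ∃ x ∈ M, f x = i
  · obtain ⟨R, hR, hRne, hRne'⟩ := exists_cut htot' hno M (fun j => by
      by_cases hj : j = i
      · subst hj; exact hMi
      · obtain ⟨x, rfl⟩ := hf j
        exact ⟨x, hMoff x hj, rfl⟩)
    have hRM := fun x (hx : x ∈ R) => (memM x).1 (hR.1 hx)
    have hcut : IsCut r f Finset.univ (P ∪ R) := by
      refine ⟨Finset.subset_univ _, fun x hx y _ hy hxy => ?_⟩
      rw [Finset.mem_union, not_or] at hy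
      rcases Finset.mem_union.1 hx with hx | hx
      · exact hP.2 x hx y (Finset.mem_univ _) hy.1 hxy
      · by_cases hyQ : y ∈ Q
        · exact hQ.2 x (Finset.mem_compl.2 (hRM x hx).2) y (Finset.mem_univ _) (by simpa using hyQ)
            hxy
        · exact hR.2 x hx y ((memM y).2 ⟨hy.1, hyQ⟩) hy.2 hxy
    have hne1 : (P ∪ R).Nonempty := hRne.mono Finset.subset_union_right
    have hsub : M \ R ⊆ (P ∪ R)ᶜ := by
      intro x hx
      rw [Finset.mem_sdiff, memM] at hx
      rw [Finset.mem_compl, Finset.mem_union]; tauto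
    have hsubQ : Q ⊆ (P ∪ R)ᶜ := by
      intro x hx
      rw [Finset.mem_compl, Finset.mem_union]
      rintro (h | h)
      · exact Finset.disjoint_left.1 hdisj h hx
      · exact (hRM x h).2 hx
    have hne2 : (P ∪ R)ᶜ.Nonempty := hRne'.mono hsub
    obtain ⟨j, hj | hj⟩ := mono _ hcut hne1 hne2
    · have hij : j = i := by
        rcases P.eq_empty_or_nonempty with h0 | ⟨x, hx⟩
        · have hQne : Q.Nonempty := Finset.card_pos.1 (by rw [h0] at hpos; simpa using hpos)
          exact colour_eq_of_monochromatic hcard hM hf hcut hQ hne1 hQne hj hQi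
        · rw [← hj x (Finset.mem_union_left _ hx), hPi x hx]
      subst hij
      have := hmax (P ∪ R, Q) (hS.2 ⟨hcut, hQ, hj, hQi, by
        rw [Finset.disjoint_left]
        exact fun x hx hxQ => Finset.mem_compl.1 (hsubQ hxQ) hx, by
        have := Finset.card_pos.2 hne1; simp only; omega⟩)
      simp only at this
      rw [Finset.card_union_of_disjoint (Finset.disjoint_left.2 fun x hx hxR =>
        (hRM x hxR).1 hx)] at this
      have := Finset.card_pos.2 hRne
      omega
    · have hij : j = i := by
        rcases Q.eq_empty_or_nonempty with h0 | ⟨x, hx⟩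
        · have hPne : P.Nonempty := Finset.card_pos.1 (by rw [h0] at hpos; simpa using hpos)
          exact (colour_eq_of_monochromatic hcard hM hf hP (by simpa using hcut) hPne hne2
            hPi hj).symm
        · rw [← hj x (hsubQ hx), hQi x hx]
      subst hij
      have := hmax (P, (P ∪ R)ᶜ) (hS.2 ⟨hP, by simpa using hcut, hPi, hj, by
        rw [Finset.disjoint_left]
        exact fun x hx hxQ => Finset.mem_compl.1 hxQ (Finset.mem_union_left _ hx), by
        have := Finset.card_pos.2 hne2; simp only; omega⟩)
      simp only at this
      have h3 : (Q ∪ (M \ R)).card ≤ (P ∪ R)ᶜ.card :=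
        Finset.card_le_card (Finset.union_subset hsubQ hsub)
      rw [Finset.card_union_of_disjoint (Finset.disjoint_left.2 fun x hx hxR =>
        ((memM x).1 (Finset.mem_sdiff.1 hxR).1).2 hx)] at h3
      have := Finset.card_pos.2 hRne'
      omega
  · push Not at hMi
    have hM2 : 2 ≤ M.card := by
      obtain ⟨y, hy, -⟩ := exists_third_colour hf i i
      obtain ⟨z, hz, hzy⟩ := exists_third_colour hf i (f y)
      exact Finset.one_lt_card.2 ⟨y, hMoff y hy, z, hMoff z hz, fun h => hzy (by rw [h])⟩
    have hMne : M.Nonempty := Finset.card_pos.1 (by omega)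
    have m1 : P.Nonempty → P.card + M.card ≤ n + 1 := fun h => hM P M (by
      intro x hx y hy
      exact hP.2 x hx y (Finset.mem_univ _) ((memM y).1 hy).1 (by
        rw [hPi x hx]; exact (hMi y hy).symm)) h hMne
    have m2 : Q.Nonempty → M.card + Q.card ≤ n + 1 := fun h => hM M Q (by
      intro x hx y hy
      exact hQ.2 x (Finset.mem_compl.2 ((memM x).1 hx).2) y (Finset.mem_univ _) (by simpa using hy)
        (by rw [hQi y hy]; exact hMi x hx)) hMne h
    rw [← Finset.card_pos] at m1 m2
    omega

/-- A tournament on `2n+1` vertices in which `X → Y` forces `|X| + |Y| ≤ n + 1`, with equality only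
if `X` or `Y` is a singleton, has a rainbow cyclic triangle in every surjective 3-colouring. -/
theorem hasRainbowTriangle_of_card_bounds (hcard : Fintype.card V = 2 * n + 1) (hn : 1 ≤ n)
    (htot : ∀ x y, x ≠ y → r x y ∨ r y x)
    (hM : ∀ X Y : Finset V, Dominates r X Y → X.Nonempty → Y.Nonempty → X.card + Y.card ≤ n + 1)
    (hN : ∀ X Y : Finset V, Dominates r X Y → 2 ≤ X.card → 2 ≤ Y.card → X.card + Y.card ≠ n + 1)
    (hf : Function.Surjective f) : HasRainbowTriangle r f := by
  by_contra hno
  obtain ⟨P, i, hP, hs⟩ := exists_splits hcard hn htot hM hf hno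
  exact hP.not_splits hcard htot hM hN hf i hs

end Cuts

section Rotational

variable {G : Type*} [AddCommGroup G] [Fintype G] [DecidableEq G]
variable {n : ℕ} {J : Finset G} {f : G → Fin 3}

/-- The rotational tournament, with symbol set `{d, 2d, …, nd}`, has a rainbow cyclic triangle in
every surjective 3-colouring. -/
theorem hasRainbowTriangle_of_progression (hcard : Fintype.card G = 2 * n + 1) (hn : 1 ≤ n) {d : G}
    (htop : AddSubgroup.zmultiples d = ⊤) (hJ : ∀ i, 1 ≤ i → i ≤ n → i • d ∈ J)
    (hf : Function.Surjective f) : HasRainbowTriangle (arc J) f := by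
  by_contra hno
  have hzero : (2 * n + 1) • d = 0 := hcard ▸ card_nsmul_eq_zero
  have tri : ∀ x y z, f x ≠ f y → f y ≠ f z → f z ≠ f x → y - x ∈ J → z - y ∈ J → x - z ∉ J :=
    fun x y z h1 h2 h3 h4 h5 h6 => hno ⟨x, y, z, h4, h5, h6, h1, h2, h3⟩
  obtain ⟨δ, hδ⟩ : ∃ δ, δ = n • d := ⟨_, rfl⟩
  have h2δ : d + 2 • δ = 0 := by rw [hδ, ← hzero, add_nsmul, mul_nsmul', one_nsmul, add_comm]
  have hδmul : ∀ m, (2 * m) • δ + m • d = 0 := by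
    intro m
    rw [mul_comm, mul_nsmul', ← nsmul_add, add_comm, h2δ, nsmul_zero]
  have hodd : ∀ m < n, (2 * m + 1) • δ ∈ J := by
    intro m hm
    have : (2 * m + 1) • δ = (n - m) • d := by
      have h1 := hδmul m
      have h2 : (n - m) • d + m • d = δ := by rw [hδ, ← add_nsmul, Nat.sub_add_cancel hm.le]
      rw [add_nsmul, one_nsmul, eq_neg_of_add_eq_zero_left h1, ← h2]
      abel
    rw [this]; exact hJ _ (by omega) (by omega)
  have hzeroδ : (2 * n + 1) • δ = 0 := hcard ▸ card_nsmul_eq_zero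
  -- every vertex has the colour of one of its two neighbours
  have nbr : ∀ z, f (z + δ) = f z ∨ f (z - δ) = f z := by
    intro z
    by_contra! hcon
    obtain ⟨h1, h2⟩ := hcon
    have a1 : (z + δ) - z ∈ J := by
      rw [add_sub_cancel_left, hδ]; exact hJ n hn le_rfl
    have a2 : z - (z - δ) ∈ J := by
      rw [sub_sub_cancel, hδ]; exact hJ n hn le_rfl
    have a3 : (z - δ) - (z + δ) ∈ J := by
      have : (z - δ) - (z + δ) = 1 • d := by
        rw [one_nsmul, eq_neg_of_add_eq_zero_left h2δ, two_nsmul]; abel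
      rw [this]; exact hJ 1 le_rfl hn
    have h3 : f (z + δ) = f (z - δ) := by
      by_contra h3
      exact tri z (z + δ) (z - δ) h1.symm h3 h2 a1 a3 a2
    obtain ⟨k, hk1, hk2⟩ : ∃ k : Fin 3, k ≠ f z ∧ k ≠ f (z + δ) := by
      generalize f z = a; generalize f (z + δ) = b; revert a b; decide
    obtain ⟨w, rfl⟩ := hf k
    obtain ⟨i, hi, hiw⟩ := exists_nsmul_eq_of_zmultiples_eq_top hcard htop (w - z)
    have hi0 : 1 ≤ i := by
      by_contra h0
      obtain rfl : i = 0 := by omega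
      rw [zero_nsmul, sub_eq_zero] at hiw
      exact hk1 (by rw [hiw])
    rcases Nat.lt_or_ge n i with hin | hin
    · refine tri z (z + δ) w h1.symm hk2.symm hk1 a1 ?_ ?_
      · have : w - (z + δ) = (i - n) • d := by
          have : (i - n) • d + n • d = i • d := by rw [← add_nsmul, Nat.sub_add_cancel hin.le]
          rw [← sub_sub, hiw, hδ, ← this, add_sub_cancel_right]
        rw [this]; exact hJ _ (by omega) (by omega)
      · have : z - w = (2 * n + 1 - i) • d := by
          have h4 : (2 * n + 1 - i) • d + i • d = 0 := by
            rw [← add_nsmul, Nat.sub_add_cancel hi.le, hzero]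
          rw [eq_neg_of_add_eq_zero_left h4, ← hiw, neg_sub]
        rw [this]; exact hJ _ (by omega) (by omega)
    · refine tri z w (z - δ) hk1.symm (by rw [← h3]; exact hk2) h2 ?_ ?_ a2
      · rw [hiw]; exact hJ _ hi0 hin
      · have : z - δ - w = (n + 1 - i) • d := by
          have h4 : (n + 1 - i) • d + (n • d + i • d) = 0 := by
            rw [← add_nsmul, ← add_nsmul, show n + 1 - i + (n + i) = 2 * n + 1 by omega, hzero]
          rw [eq_neg_of_add_eq_zero_left h4, ← hiw, ← hδ]; abel
        rw [this]; exact hJ _ (by omega) (by omega)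
  obtain ⟨z, hz⟩ := hf 2
  have htopδ : AddSubgroup.zmultiples δ = ⊤ := by
    rw [eq_top_iff, ← htop, AddSubgroup.zmultiples_le]
    rw [eq_neg_of_add_eq_zero_left h2δ]
    exact neg_mem (nsmul_mem (AddSubgroup.mem_zmultiples δ) 2)
  -- every colour other than that of `z` occurs at two consecutive positions
  have block : ∀ c : Fin 3, c ≠ 2 → ∃ k, 1 ≤ k ∧ k + 1 ≤ 2 * n ∧ f (z + k • δ) = c ∧
      f (z + (k + 1) • δ) = c := by
    intro c hc
    obtain ⟨a, ha⟩ := hf c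
    obtain ⟨k, hk, hka⟩ := exists_nsmul_eq_of_zmultiples_eq_top hcard htopδ (a - z)
    obtain rfl : a = z + k • δ := by rw [← hka]; abel
    have hk0 : k ≠ 0 := by
      rintro rfl
      rw [zero_nsmul, add_zero, hz] at ha
      exact hc ha.symm
    rcases nbr (z + k • δ) with h | h
    · refine ⟨k, by omega, ?_, ha, ?_⟩
      · by_contra hlt
        obtain rfl : k = 2 * n := by omega
        rw [add_assoc, ← succ_nsmul, hzeroδ, add_zero, hz, ha] at h
        exact hc h.symm
      · rw [succ_nsmul, ← add_assoc, h, ha]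
    · obtain ⟨m, rfl⟩ := Nat.exists_eq_succ_of_ne_zero hk0
      rw [Nat.succ_eq_add_one] at *
      rw [succ_nsmul, ← add_assoc, add_sub_cancel_right, add_assoc, ← succ_nsmul, ha] at h
      refine ⟨m, ?_, by omega, h, ha⟩
      by_contra hlt
      obtain rfl : m = 0 := by omega
      rw [zero_nsmul, add_zero, hz] at h
      exact hc h.symm
  have final : ∀ a b : Fin 3, a ≠ 2 → b ≠ 2 → a ≠ b → ∀ k l, 1 ≤ k → k < l → l + 1 ≤ 2 * n →
      f (z + k • δ) = a → f (z + (k + 1) • δ) = a → f (z + l • δ) = b →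
      f (z + (l + 1) • δ) = b → False := by
    intro a b ha hb hab k l hk hkl hl fk fk' fl fl'
    have hkl' : k + 1 ≠ l := by
      rintro rfl
      exact hab (fk'.symm.trans fl)
    obtain ⟨u, hu1, hu2, hu3⟩ : ∃ u, f (z + (2 * u + 1) • δ) = a ∧ k ≤ 2 * u + 1 ∧
        2 * u + 1 ≤ k + 1 := by
      rcases Nat.even_or_odd' k with ⟨m, rfl | rfl⟩
      · exact ⟨m, fk', by omega, by omega⟩
      · exact ⟨m, fk, by omega, by omega⟩
    obtain ⟨v, hv1, hv2, hv3⟩ : ∃ v, f (z + (2 * v) • δ) = b ∧ l ≤ 2 * v ∧ 2 * v ≤ l + 1 := by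
      rcases Nat.even_or_odd' l with ⟨m, rfl | rfl⟩
      · exact ⟨m, fl, by omega, by omega⟩
      · exact ⟨m + 1, fl', by omega, by omega⟩
    refine tri z (z + (2 * u + 1) • δ) (z + (2 * v) • δ) (by rw [hz, hu1]; exact ha.symm)
      (by rw [hu1, hv1]; exact hab) (by rw [hz, hv1]; exact hb) ?_ ?_ ?_
    · rw [add_sub_cancel_left]; exact hodd u (by omega)
    · have : z + (2 * v) • δ - (z + (2 * u + 1) • δ) = (2 * (v - u - 1) + 1) • δ := by
        rw [add_sub_add_left_eq_sub, sub_eq_iff_eq_add, ← add_nsmul]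
        congr 1; omega
      rw [this]; exact hodd _ (by omega)
    · have : z - (z + (2 * v) • δ) = (2 * (n - v) + 1) • δ := by
        rw [sub_eq_iff_eq_add, add_comm z, ← add_assoc, ← add_nsmul,
          show 2 * (n - v) + 1 + 2 * v = 2 * n + 1 by omega, hzeroδ, zero_add]
      rw [this]; exact hodd _ (by omega)
  obtain ⟨k, hk, hk', fk, fk'⟩ := block 0 (by decide)
  obtain ⟨l, hl, hl', fl, fl'⟩ := block 1 (by decide)
  rcases lt_trichotomy k l with h | rfl | h
  · exact final 0 1 (by decide) (by decide) (by decide) k l hk h hl' fk fk' fl fl'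
  · rw [fk] at fl; exact absurd fl (by decide)
  · exact final 1 0 (by decide) (by decide) (by decide) l k hl h hk' fl fl' fk fk'

end Rotational

section Prime

variable {G : Type} [AddCommGroup G]

/-- A digraph of differences with a homogeneous nontrivial proper subgroup is a composition. -/
theorem isPrimeSet_of_isSimple {J : Finset G}
    {D : Digraph G} (hD : ∀ x y, D.Adj x y ↔ y - x ∈ J) (h : IsSimple D) : IsPrimeSet J := by
  intro H hH
  by_contra! hne
  obtain ⟨hbot, htop⟩ := hne
  have : Nontrivial H := (AddSubgroup.nontrivial_iff_ne_bot H).2 hbot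
  have : Nontrivial (G ⧸ H) := QuotientAddGroup.nontrivial_iff.2 htop
  let D₁ : Digraph (G ⧸ H) := ⟨fun p q => p ≠ q ∧ ∃ x y : G, (x : G ⧸ H) = p ∧ (y : G ⧸ H) = q ∧
    y - x ∈ J⟩
  let D₂ : Digraph H := ⟨fun a b => (b : G) - a ∈ J⟩
  have hout : ∀ x : G, x - (x : G ⧸ H).out ∈ H := fun x => by
    have : (((x : G ⧸ H).out : G) : G ⧸ H) = x := Quotient.out_eq _
    rw [QuotientAddGroup.eq] at this
    rwa [sub_eq_neg_add]
  let e : G ≃ (G ⧸ H) × H :=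
    { toFun := fun x => (x, ⟨x - (x : G ⧸ H).out, hout x⟩)
      invFun := fun p => p.1.out + p.2
      left_inv := fun x => by simp
      right_inv := fun p => by
        obtain ⟨q, t⟩ := p
        have h1 : ((q.out + (t : G) : G) : G ⧸ H) = q := by
          rw [QuotientAddGroup.mk_add_of_mem _ t.2]; exact Quotient.out_eq q
        ext
        · exact h1
        · show q.out + (t : G) - ((q.out + (t : G) : G) : G ⧸ H).out = t
          rw [h1, add_sub_cancel_left] }
  refine h (G ⧸ H) H D₁ D₂ ⟨e, ?_⟩
  intro x y
  rw [hD]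
  show (((x : G ⧸ H) = y ∧ (y - (y : G ⧸ H).out) - (x - (x : G ⧸ H).out) ∈ J) ∨
    ((x : G ⧸ H) ≠ y ∧ ∃ x' y' : G, (x' : G ⧸ H) = x ∧ (y' : G ⧸ H) = y ∧ y' - x' ∈ J)) ↔ _
  by_cases hxy : (x : G ⧸ H) = y
  · simp [hxy]
  · simp only [hxy, false_and, false_or, ne_eq, not_false_eq_true, true_and]
    constructor
    · rintro ⟨x', y', hx', hy', hJ⟩
      rw [QuotientAddGroup.eq] at hx' hy'
      have hnot : y' - x' ∉ H := by
        intro hmem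
        apply hxy
        rw [QuotientAddGroup.eq]
        have := H.add_mem (H.add_mem (H.neg_mem hx') hy') hmem
        rwa [show -(-x' + x) + (-y' + y) + (y' - x') = -x + y by abel] at this
      have := hH _ hnot hJ _ (H.add_mem (H.neg_mem hx') hy')
      rwa [show y' - x' + (-(-x' + x) + (-y' + y)) = y - x by abel] at this
    · intro hJ
      exact ⟨x, y, rfl, rfl, hJ⟩

end Prime

/-- In a prime tournament of differences every surjective 3-colouring has a rainbow cyclic
triangle. -/
theorem IsPrimeSet.hasRainbowTriangle {G : Type*} [AddCommGroup G] [Fintype G] [DecidableEq G]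
    {n : ℕ} (hn : 1 ≤ n) {J : Finset G} (hJ : IsTournamentSet n J) (hP : IsPrimeSet J)
    {f : G → Fin 3} (hf : Function.Surjective f) : HasRainbowTriangle (arc J) f := by
  by_cases h : ∃ X Y : Finset G, Dominates (arc J) X Y ∧ 2 ≤ X.card ∧ 2 ≤ Y.card ∧
      X.card + Y.card = n + 1
  · obtain ⟨X, Y, hd, hX, hY, hc⟩ := h
    obtain ⟨d, htop, hmem⟩ := exists_progression_of_critical hJ hP hd hX hY hc
    exact hasRainbowTriangle_of_progression hJ.card_univ hn htop hmem hf
  · push Not at h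
    refine hasRainbowTriangle_of_card_bounds hJ.card_univ hn ?_
      (fun X Y hd hX hY => card_add_card_le hJ hP hd hX hY) h hf
    intro x y hxy
    have := hJ.total (y - x) (sub_ne_zero.2 hxy.symm)
    rwa [neg_sub] at this

theorem IsSymbolSet.isTournamentSet {n : ℕ} {J : Finset (ZMod (2 * n + 1))}
    (hJ : IsSymbolSet n J) : IsTournamentSet n J := by
  have hcard : Fintype.card (ZMod (2 * n + 1)) = 2 * n + 1 := ZMod.card _
  have hanti : ∀ x ∈ J, -x ∉ J := by
    intro x hx hnx
    have h1 := hJ.card_inter x hx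
    rw [Finset.inter_eq_left.2 (by
      intro y hy
      rcases Finset.mem_insert.1 hy with rfl | hy
      · exact hx
      · rwa [Finset.mem_singleton.1 hy])] at h1
    have h2 : x = -x := by
      by_contra hne
      rw [Finset.card_pair hne] at h1
      omega
    have h3 : addOrderOf x ∣ 2 := addOrderOf_dvd_of_nsmul_eq_zero (by
      rw [two_nsmul]; nth_rewrite 2 [h2]; exact add_neg_cancel x)
    have h4 : addOrderOf x ∣ 2 * n + 1 := by
      have := addOrderOf_dvd_card (x := x)
      rwa [hcard] at this
    have h5 : addOrderOf x ∣ 1 := (Nat.dvd_add_right (h3.mul_right n)).1 h4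
    rw [Nat.dvd_one, AddMonoid.addOrderOf_eq_one_iff] at h5
    exact hJ.zero_notMem (h5 ▸ hx)
  refine ⟨hJ.zero_notMem, ?_, hanti, hJ.card_eq, hcard⟩
  have hdisj : Disjoint J (negateSet J) := Finset.disjoint_left.2 fun x hx hx' =>
    hanti x hx (mem_negate.1 hx')
  have h0 : (0 : ZMod (2 * n + 1)) ∉ J ∪ negateSet J := by
    rw [Finset.mem_union, mem_negate, neg_zero, or_self]; exact hJ.zero_notMem
  have huniv : insert 0 (J ∪ negateSet J) = Finset.univ := by
    rw [← Finset.card_eq_iff_eq_univ, Finset.card_insert_of_notMem h0,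
      Finset.card_union_of_disjoint hdisj, card_negate, hJ.card_eq, hcard]
    omega
  intro x hx
  have := huniv ▸ Finset.mem_univ x
  rw [Finset.mem_insert, Finset.mem_union, mem_negate] at this
  exact this.resolve_left hx

/-- If every 3-colouring with all colours has a rainbow cyclic triangle, at most two components
remain after deleting a triangle-free subdigraph. -/
theorem omega3_le_two {V : Type*} {D : Digraph V}
    (h : ∀ f : V → Fin 3, Function.Surjective f → HasRainbowTriangle D.Adj f) :
    omega3 D ≤ 2 := by
  classical
  refine iSup_le fun ⟨H, hHD, hH⟩ => ?_
  by_contra! hlt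
  set Γ := (D \ H).toSimpleGraphInclusive with hΓ
  have h3 : 3 ≤ ENat.card Γ.ConnectedComponent := Order.add_one_le_of_lt hlt
  have : Nontrivial Γ.ConnectedComponent :=
    (ENat.one_lt_card_iff_nontrivial _).1 (lt_trans (by norm_num) hlt)
  obtain ⟨a, b, hab⟩ := exists_pair_ne Γ.ConnectedComponent
  obtain ⟨c, hac, hbc⟩ := ENat.exists_ne_ne_of_three_le h3 a b
  let g : Γ.ConnectedComponent → Fin 3 := fun u => if u = a then 0 else if u = b then 1 else 2
  obtain ⟨x, y, z, h1, h2, h3, n1, n2, n3⟩ := h (fun v => g (Γ.connectedComponentMk v)) (by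
    intro i
    have hsurj : ∃ u, g u = i := by
      fin_cases i
      · exact ⟨a, by simp [g]⟩
      · exact ⟨b, by simp [g, hab.symm]⟩
      · exact ⟨c, by simp [g, hac, hbc]⟩
    obtain ⟨u, rfl⟩ := hsurj
    obtain ⟨v, rfl⟩ := u.exists_rep
    exact ⟨v, rfl⟩)
  have key : ∀ u v, D.Adj u v → g (Γ.connectedComponentMk u) ≠ g (Γ.connectedComponentMk v) →
      u ≠ v ∧ H.Adj u v := by
    intro u v huv hne
    refine ⟨fun h => hne (by rw [h]), ?_⟩
    by_contra hH'
    have hadj : Γ.Adj u v := by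
      rw [hΓ, Digraph.toSimpleGraphInclusive, SimpleGraph.fromRel_adj]
      exact ⟨fun h => hne (by rw [h]), Or.inl ⟨huv, hH'⟩⟩
    exact hne (congrArg g (SimpleGraph.ConnectedComponent.sound hadj.reachable))
  obtain ⟨e1, k1⟩ := key x y h1 n1
  obtain ⟨e2, k2⟩ := key y z h2 n2
  obtain ⟨e3, k3⟩ := key z x h3 n3
  exact hH ⟨x, y, z, e1, e2, e3, k1, k2, k3⟩

/-- Deleting all the arcs at one vertex leaves at least two components. -/
theorem two_le_omega3 {V : Type*} [Nontrivial V] (D : Digraph V) : 2 ≤ omega3 D := by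
  obtain ⟨a, b, hab⟩ := exists_pair_ne V
  let H : Digraph V := ⟨fun x y => D.Adj x y ∧ (x = a ∨ y = a)⟩
  have hH : H ≤ D ∧ C3Free H := by
    refine ⟨fun x y h => h.1, ?_⟩
    rintro ⟨x, y, z, h1, h2, h3, ⟨-, k1⟩, ⟨-, k2⟩, ⟨-, k3⟩⟩
    grind
  refine le_trans ?_ (le_iSup (fun H : {H : Digraph V // H ≤ D ∧ C3Free H} =>
    ENat.card (D \ H.1).toSimpleGraphInclusive.ConnectedComponent) ⟨H, hH⟩)
  set Γ := (D \ H).toSimpleGraphInclusive with hΓ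
  have hiso : ∀ v, ¬ Γ.Adj a v := by
    intro v hv
    rw [hΓ, Digraph.toSimpleGraphInclusive, SimpleGraph.fromRel_adj] at hv
    rcases hv.2 with h | h
    · exact h.2 ⟨h.1, Or.inl rfl⟩
    · exact h.2 ⟨h.1, Or.inr rfl⟩
  have hne : Γ.connectedComponentMk a ≠ Γ.connectedComponentMk b := by
    intro h
    obtain ⟨w⟩ := SimpleGraph.ConnectedComponent.exact h
    cases w with
    | nil => exact hab rfl
    | cons h _ => exact hiso _ h
  have : Nontrivial Γ.ConnectedComponent := ⟨_, _, hne⟩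
  have h1 := (ENat.one_lt_card_iff_nontrivial Γ.ConnectedComponent).2 this
  exact Order.add_one_le_of_lt h1

end CircTournament

theorem mainTheorem5 (n : ℕ) (hn : 1 ≤ n) (J : Finset (ZMod (2 * n + 1)))
    (hJ : CircTournament.IsSymbolSet n J)
    (hsimple : CircTournament.IsSimple (CircTournament.circulant n J)) :
    CircTournament.IsTight (CircTournament.circulant n J) := by
  have hP := CircTournament.isPrimeSet_of_isSimple (fun _ _ => Iff.rfl) hsimple
  have : Fact (1 < 2 * n + 1) := ⟨by omega⟩
  refine le_antisymm (CircTournament.omega3_le_two fun f hf => ?_)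
    (CircTournament.two_le_omega3 _)
  exact hP.hasRainbowTriangle hn hJ.isTournamentSet hf
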